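/- Let $\mathscr H$ be a complex Hilbert space. For $1<p<\infty$ let $\mathbb B_p(\mathscr H)$ be the Schatten class of all compact operators $T$ on $\mathscr H$ with $\|T\|_p=\big(\sum_j s_j(T)^p\big)^{1/p}<\infty$, where $s_1(T)\ge s_2(T)\ge\cdots$ are the singular values of $T$ (the square roots of the eigenvalues of $T^*T$, repeated according to multiplicity), and let $q=p/(p-1)$ be the conjugate exponent. Let $U=(u_{ij})$ be a subunitary complex $s\times t$ matrix, that is, a matrix with orthonormal columns: $U^*U=I_t$ (so $s\ge t$). Let $X_1,\dots,X_s,Y_1,\dots,Y_t\in\mathbb B_p(\mathscr H)$. (i) If $1<p\le 2$ and $X_i=\sum_{j=1}^t u_{ij}Y_j$ for $i=1,\dots,s$, then $$\sum_{i=1}^s\|X_i\|_p^q\le\Big(\max_{i,j}|u_{ij}|\Big)^{\frac qp-1}\Big(\sum_{j=1}^t\|Y_j\|_p^p\Big)^{\frac qp}.$$ (ii) If $2\le p<\infty$ and $X_i=\sum_{j=1}^t\overline{u_{ij}}\,Y_j$ for $i=1,\dots,s$, then $$\sum_{i=1}^s\|X_i\|_p^q\ge\Big(\max_{i,j}|u_{ij}|\Big)^{\frac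 qp-1}\Big(\sum_{j=1}^t\|Y_j\|_p^p\Big)^{\frac qp}.$$ -/

import Mathlib

open scoped ENNReal

noncomputable section

/-- The multiplicity of `σ > 0` as a singular value of a (compact) operator `T` on a Hilbert space,
i.e. the dimension of the eigenspace of `T* T` for the eigenvalue `σ ^ 2`. For compact `T` and
`σ > 0` this eigenspace is finite-dimensional. -/
def singularMultiplicity {H : Type*} [NormedAddCommGroup H] [InnerProductSpace ℂ H]
    [CompleteSpace H] (T : H →L[ℂ] H) (σ : ℝ) : ℕ :=
  Module.finrank ℂ
    (Module.End.eigenspace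
      ((ContinuousLinearMap.adjoint T ∘L T : H →L[ℂ] H) : H →ₗ[ℂ] H) ((σ : ℂ) ^ 2))

/-- The sum `∑ⱼ sⱼ(T) ^ p` over the nonzero singular values of a compact operator `T`, each
repeated according to its multiplicity. -/
def schattenSum {H : Type*} [NormedAddCommGroup H] [InnerProductSpace ℂ H]
    [CompleteSpace H] (p : ℝ) (T : H →L[ℂ] H) : ℝ≥0∞ :=
  ∑' σ : {σ : ℝ // 0 < σ},
    (singularMultiplicity T (σ : ℝ) : ℝ≥0∞) * ENNReal.ofReal ((σ : ℝ) ^ p)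

/-- The Schatten `p`-class: compact operators whose singular values are `p`-summable. -/
def MemSchatten {H : Type*} [NormedAddCommGroup H] [InnerProductSpace ℂ H]
    [CompleteSpace H] (p : ℝ) (T : H →L[ℂ] H) : Prop :=
  IsCompactOperator T ∧ schattenSum p T ≠ ∞

/-- The Schatten `p`-norm `(∑ⱼ sⱼ(T) ^ p) ^ (1 / p)` of an operator of the Schatten `p`-class. -/
def schattenNorm {H : Type*} [NormedAddCommGroup H] [InnerProductSpace ℂ H]
    [CompleteSpace H] (p : ℝ) (T : H →L[ℂ] H) : ℝ :=
  (schattenSum p T).toReal ^ (1 / p)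

/-- An `s × t` matrix is subunitary if its columns are orthonormal (so that `t ≤ s`). -/
def IsSubunitary {s t : ℕ} (U : Matrix (Fin s) (Fin t) ℂ) : Prop :=
  U.conjTranspose * U = 1

/-- The largest modulus of an entry of a matrix. -/
def maxEntry {s t : ℕ} (U : Matrix (Fin s) (Fin t) ℂ) : ℝ :=
  ⨆ k : Fin s × Fin t, ‖U k.1 k.2‖

end

/-!
By duality it suffices to bound the bilinear form `∑ᵢⱼ uᵢⱼ Tr (Aⱼ Bᵢ)`. Expand the operators `Aⱼ`
and `Bᵢ` in singular values. The kernel of the resulting form in the singular values is bounded by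
`M = max |uᵢⱼ|` on `ℓ¹ × ℓ^∞` (trace norm against operator norm), and, because the columns of `U`
are orthonormal, it is contractive on `ℓ² × ℓ²` (Hilbert–Schmidt norm against Hilbert–Schmidt norm).
The three lines theorem interpolates between the two: for `2 ≤ p` the form is at most
`M ^ (1 - 2 / p) * (∑ⱼ ‖Aⱼ‖_q ^ q) ^ (1 / q) * (∑ᵢ ‖Bᵢ‖_p ^ q) ^ (1 / q)`. For (i), with the roles
of `p` and `q` exchanged, take `Aⱼ = Yⱼ` and let `Bᵢ` norm `Xᵢ`. For (ii), where `Yⱼ = ∑ᵢ uᵢⱼ Xᵢ`,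
take `Bᵢ = Xᵢ` and let `Aⱼ` norm `Yⱼ`.
-/

open Filter Topology
open scoped InnerProductSpace TensorProduct ComplexConjugate

section SingularValueDecomposition

variable {𝕜 E F : Type*} [RCLike 𝕜] [NormedAddCommGroup E] [InnerProductSpace 𝕜 E]
  [CompleteSpace E] [NormedAddCommGroup F] [InnerProductSpace 𝕜 F]

theorem apply_eq_zero_of_orthogonal_eigenspaces {S : E →L[𝕜] E} (hSc : IsCompactOperator S)
    (hS : (S : E →ₗ[𝕜] E).IsSymmetric) {x : E}
    (hx : ∀ μ ≠ 0, ∀ w ∈ Module.End.eigenspace (S : E →ₗ[𝕜] E) μ, ⟪w, x⟫_𝕜 = 0) : S x = 0 := by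
  rw [← Submodule.mem_bot 𝕜,
    ← ContinuousLinearMap.orthogonalComplement_iSup_eigenspaces_eq_bot hSc hS,
    ← Submodule.iInf_orthogonal, Submodule.mem_iInf]
  intro μ w hw
  have hSw : ⟪w, S x⟫_𝕜 = conj μ * ⟪w, x⟫_𝕜 := by
    rw [← inner_smul_left, ← Module.End.mem_eigenspace_iff.1 hw]
    exact (hS w x).symm
  rcases eq_or_ne μ 0 with rfl | hμ
  · simpa using hSw
  · rw [hSw, hx μ hμ w hw, mul_zero]

theorem hasSum_inner_smul_map {ι : Type*} {e : ι → E} (he : Orthonormal 𝕜 e) (T : E →L[𝕜] F)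
    (hT : ∀ x, (∀ k, ⟪e k, x⟫_𝕜 = 0) → T x = 0) (x : E) :
    HasSum (fun k => ⟪e k, x⟫_𝕜 • T (e k)) (T x) := by
  obtain ⟨y, hy⟩ : Summable fun k => ⟪e k, x⟫_𝕜 • e k := by
    simpa using (he.orthogonalFamily.summable_iff_norm_sq_summable fun k => ⟪e k, x⟫_𝕜).2
      (he.inner_products_summable x)
  have hinner : ∀ k, ⟪e k, y⟫_𝕜 = ⟪e k, x⟫_𝕜 := fun k => by
    classical
    refine (hy.mapL (innerSL 𝕜 (e k))).unique ?_
    convert hasSum_ite_eq k ⟪e k, x⟫_𝕜 using 2 with l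
    simp only [innerSL_apply_apply, inner_smul_right, orthonormal_iff_ite.1 he]
    aesop
  have hTxy : T x = T y := sub_eq_zero.1 <| by
    rw [← map_sub]
    exact hT _ fun k => by rw [inner_sub_right, hinner, sub_self]
  simpa [hTxy] using hy.mapL T

theorem exists_sq_eq_of_hasEigenvalue_adjoint_comp_self [CompleteSpace F] {T : E →L[𝕜] F} {μ : 𝕜}
    (hμ : Module.End.HasEigenvalue
      ((ContinuousLinearMap.adjoint T ∘L T : E →L[𝕜] E) : E →ₗ[𝕜] E) μ) (hμ0 : μ ≠ 0) :
    ∃ σ : ℝ, 0 < σ ∧ (σ : 𝕜) ^ 2 = μ := by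
  obtain ⟨w, hw⟩ := hμ.exists_hasEigenvector
  have hw0 : (‖w‖ : 𝕜) ≠ 0 := by simpa using hw.2
  have hnorm : (‖T w‖ : 𝕜) ^ 2 = μ * (‖w‖ : 𝕜) ^ 2 := by
    have hTw : ⟪w, (ContinuousLinearMap.adjoint T) (T w)⟫_𝕜 = ⟪w, μ • w⟫_𝕜 :=
      congrArg _ hw.apply_eq_smul
    rwa [ContinuousLinearMap.adjoint_inner_right, inner_smul_right, inner_self_eq_norm_sq_to_K,
      inner_self_eq_norm_sq_to_K] at hTw
  have hσ : ((‖T w‖ / ‖w‖ : ℝ) : 𝕜) ^ 2 = μ := by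
    push_cast
    rw [div_pow, hnorm, mul_div_cancel_right₀ _ (pow_ne_zero 2 hw0)]
  refine ⟨‖T w‖ / ‖w‖, lt_of_le_of_ne (by positivity) fun h => hμ0 ?_, hσ⟩
  rw [← hσ, ← h, RCLike.ofReal_zero, zero_pow two_ne_zero]

end SingularValueDecomposition

/-- A pair of orthonormal systems, the right and left singular vectors of the operators
`∑ₖ σₖ |left k⟩⟨right k|`. -/
structure SingularSystem (ι H : Type*) [NormedAddCommGroup H] [InnerProductSpace ℂ H] where
  right : ι → H
  left : ι → H
  orthonormal_right : Orthonormal ℂ right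
  orthonormal_left : Orthonormal ℂ left

/-- Singular value decomposition: `T = ∑ₖ σₖ |left k⟩⟨right k|` in the strong operator topology,
with positive singular values `σₖ`. -/
structure HasSVD {ι H : Type*} [NormedAddCommGroup H] [InnerProductSpace ℂ H] (T : H →L[ℂ] H)
    (σ : ι → ℝ) (s : SingularSystem ι H) : Prop where
  pos : ∀ k, 0 < σ k
  hasSum : ∀ x, HasSum (fun k => ((σ k : ℂ) * ⟪s.right k, x⟫_ℂ) • s.left k) (T x)

namespace HasSVD

variable {ι H : Type*} [NormedAddCommGroup H] [InnerProductSpace ℂ H] {T : H →L[ℂ] H} {σ : ι → ℝ}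
  {s : SingularSystem ι H}

theorem hasSum_inner (hT : HasSVD T σ s) (x y : H) :
    HasSum (fun k => (σ k : ℂ) * (⟪s.right k, x⟫_ℂ * ⟪y, s.left k⟫_ℂ)) ⟪y, T x⟫_ℂ := by
  simpa [inner_smul_right, mul_assoc] using (hT.hasSum x).mapL (innerSL ℂ y)

theorem inner_left_apply_right (hT : HasSVD T σ s) (k : ι) :
    ⟪s.left k, T (s.right k)⟫_ℂ = σ k := by
  classical
  refine (hT.hasSum_inner (s.right k) (s.left k)).unique ?_
  convert hasSum_ite_eq k (σ k : ℂ) using 2 with l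
  rw [orthonormal_iff_ite.1 s.orthonormal_right, orthonormal_iff_ite.1 s.orthonormal_left]
  aesop

end HasSVD

section Schatten

variable {H : Type*} [NormedAddCommGroup H] [InnerProductSpace ℂ H] [CompleteSpace H]

/-- Index set of the positive singular values of `T`, repeated according to multiplicity. -/
abbrev SingularIndex (T : H →L[ℂ] H) : Type :=
  Σ σ : {σ : ℝ // 0 < σ}, Fin (singularMultiplicity T σ)

theorem schattenSum_eq_tsum_singularIndex (p : ℝ) (T : H →L[ℂ] H) :
    schattenSum p T = ∑' k : SingularIndex T, ENNReal.ofReal ((k.1 : ℝ) ^ p) := by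
  rw [ENNReal.tsum_sigma fun (σ : {σ : ℝ // 0 < σ}) (_ : Fin (singularMultiplicity T σ)) =>
    ENNReal.ofReal ((σ : ℝ) ^ p)]
  simp [schattenSum]

theorem exists_rightSingularVectors {T : H →L[ℂ] H} (hT : IsCompactOperator T) :
    ∃ e : SingularIndex T → H, Orthonormal ℂ e ∧
      (∀ k, (ContinuousLinearMap.adjoint T) (T (e k)) = ((k.1 : ℝ) : ℂ) ^ 2 • e k) ∧
      ∀ x, (∀ k, ⟪e k, x⟫_ℂ = 0) → T x = 0 := by
  set S : H →L[ℂ] H := ContinuousLinearMap.adjoint T ∘L T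
  have hSc : IsCompactOperator S := hT.clm_comp (ContinuousLinearMap.adjoint T)
  have hS : (S : H →ₗ[ℂ] H).IsSymmetric :=
    (ContinuousLinearMap.isPositive_adjoint_comp_self T).isSymmetric
  have hfin : ∀ σ : {σ : ℝ // 0 < σ}, FiniteDimensional ℂ
      (Module.End.eigenspace (S : H →ₗ[ℂ] H) (((σ : ℝ) : ℂ) ^ 2)) := fun σ =>
    ContinuousLinearMap.finite_dimensional_eigenspace hSc _
      (pow_ne_zero 2 (Complex.ofReal_ne_zero.2 σ.2.ne'))
  have hinj : Function.Injective fun σ : {σ : ℝ // 0 < σ} => ((σ : ℝ) : ℂ) ^ 2 := by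
    intro σ τ h
    have hsq : ((σ : ℝ) : ℂ) ^ 2 = ((τ : ℝ) : ℂ) ^ 2 := h
    exact Subtype.ext ((pow_left_inj₀ σ.2.le τ.2.le two_ne_zero).1 (by exact_mod_cast hsq))
  let b := fun σ : {σ : ℝ // 0 < σ} =>
    stdOrthonormalBasis ℂ (Module.End.eigenspace (S : H →ₗ[ℂ] H) (((σ : ℝ) : ℂ) ^ 2))
  refine ⟨fun k => b k.1 k.2,
    (hS.orthogonalFamily_eigenspaces.comp hinj).orthonormal_sigma_orthonormal
      fun σ => (b σ).orthonormal,
    fun k => Module.End.mem_eigenspace_iff.1 (b k.1 k.2).2, fun x hx => ?_⟩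
  have hSx : S x = 0 := by
    refine apply_eq_zero_of_orthogonal_eigenspaces hSc hS fun μ hμ w hw => ?_
    rcases eq_or_ne w 0 with rfl | hw0
    · exact inner_zero_left x
    obtain ⟨σ, hσ, rfl⟩ := exists_sq_eq_of_hasEigenvalue_adjoint_comp_self
      (Module.End.hasEigenvalue_of_hasEigenvector ⟨hw, hw0⟩) hμ
    have hexp : w = ∑ n, ⟪b ⟨σ, hσ⟩ n, ⟨w, hw⟩⟫_ℂ • (b ⟨σ, hσ⟩ n : H) := by
      simpa using (congrArg Subtype.val ((b ⟨σ, hσ⟩).sum_repr' ⟨w, hw⟩)).symm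
    rw [hexp, sum_inner]
    exact Finset.sum_eq_zero fun n _ => by rw [inner_smul_left, hx ⟨⟨σ, hσ⟩, n⟩, mul_zero]
  have hker : x ∈ (S : H →ₗ[ℂ] H).ker := hSx
  rwa [ContinuousLinearMap.ker_adjoint_comp_self] at hker

theorem exists_hasSVD_of_isCompactOperator {T : H →L[ℂ] H} (hT : IsCompactOperator T) :
    ∃ s : SingularSystem (SingularIndex T) H, HasSVD T (fun k => k.1) s := by
  classical
  obtain ⟨e, he, hTe, hker⟩ := exists_rightSingularVectors hT
  have hne : ∀ k : SingularIndex T, ((k.1 : ℝ) : ℂ) ≠ 0 := fun k =>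
    Complex.ofReal_ne_zero.2 k.1.2.ne'
  have hleft : Orthonormal ℂ fun k => ((k.1 : ℝ) : ℂ)⁻¹ • T (e k) := by
    refine orthonormal_iff_ite.2 fun k l => ?_
    rw [inner_smul_left, inner_smul_right, ← ContinuousLinearMap.adjoint_inner_right, hTe,
      inner_smul_right, orthonormal_iff_ite.1 he]
    rcases eq_or_ne k l with rfl | hkl
    · simp [pow_two, hne]
    · simp [hkl]
  refine ⟨⟨e, fun k => ((k.1 : ℝ) : ℂ)⁻¹ • T (e k), he, hleft⟩, fun k => k.1.2, fun x => ?_⟩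
  convert hasSum_inner_smul_map he T hker x using 2 with k
  rw [smul_smul, mul_right_comm, mul_inv_cancel₀ (hne k), one_mul]

theorem schattenNorm_rpow_self {p : ℝ} (hp : p ≠ 0) (T : H →L[ℂ] H) :
    schattenNorm p T ^ p = (schattenSum p T).toReal := by
  rw [schattenNorm, ← Real.rpow_mul ENNReal.toReal_nonneg, one_div_mul_cancel hp, Real.rpow_one]

theorem schattenNorm_nonneg (p : ℝ) (T : H →L[ℂ] H) : 0 ≤ schattenNorm p T :=
  Real.rpow_nonneg ENNReal.toReal_nonneg _

theorem schattenNorm_rpow_rpow_div {p : ℝ} (hp : p ≠ 0) (q : ℝ) (T : H →L[ℂ] H) :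
    (schattenNorm p T ^ p) ^ (q / p) = schattenNorm p T ^ q := by
  rw [← Real.rpow_mul (schattenNorm_nonneg p T), mul_div_cancel₀ q hp]

theorem MemSchatten.exists_hasSVD {p : ℝ} (hp : p ≠ 0) {T : H →L[ℂ] H} (hT : MemSchatten p T) :
    ∃ (ι : Type) (σ : ι → ℝ) (s : SingularSystem ι H), HasSVD T σ s ∧
      HasSum (fun k => σ k ^ p) (schattenNorm p T ^ p) := by
  obtain ⟨s, hs⟩ := exists_hasSVD_of_isCompactOperator hT.1
  refine ⟨_, _, s, hs, ?_⟩
  have hfin := hT.2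
  rw [schattenNorm_rpow_self hp]
  rw [schattenSum_eq_tsum_singularIndex] at hfin ⊢
  rw [ENNReal.tsum_toReal_eq fun _ => ENNReal.ofReal_ne_top]
  convert ENNReal.hasSum_toReal hfin using 2 with k
  exact (ENNReal.toReal_ofReal (Real.rpow_nonneg k.1.2.le p)).symm

end Schatten

section Conjugation

variable {𝕜 E : Type*} [RCLike 𝕜] [NormedAddCommGroup E] [InnerProductSpace 𝕜 E]

theorem exists_conjugation [CompleteSpace E] :
    ∃ C : E → E, ∀ x y, ⟪C x, C y⟫_𝕜 = ⟪y, x⟫_𝕜 := by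
  obtain ⟨w, b, -⟩ := exists_hilbertBasis 𝕜 E
  refine ⟨fun x => b.repr.symm (star (b.repr x)), fun x y => ?_⟩
  rw [LinearIsometryEquiv.inner_map_map, ← b.repr.inner_map_map y x, lp.inner_eq_tsum,
    lp.inner_eq_tsum]
  refine tsum_congr fun i => ?_
  simp [RCLike.inner_apply, mul_comm]

theorem orthonormal_tmul_conjugation {ι : Type*} {C : E → E} (hC : ∀ x y, ⟪C x, C y⟫_𝕜 = ⟪y, x⟫_𝕜)
    {v w : ι → E} (hv : Orthonormal 𝕜 v) (hw : Orthonormal 𝕜 w) :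
    Orthonormal 𝕜 fun k => v k ⊗ₜ[𝕜] C (w k) := by
  classical
  refine orthonormal_iff_ite.2 fun k l => ?_
  rw [TensorProduct.inner_tmul, hC, orthonormal_iff_ite.1 hv, orthonormal_iff_ite.1 hw]
  aesop

theorem norm_sq_sum_smul_of_orthonormal {ι : Type*} [Fintype ι] {v : ι → E}
    (hv : Orthonormal 𝕜 v) (c : ι → 𝕜) : ‖∑ k, c k • v k‖ ^ 2 = ∑ k, ‖c k‖ ^ 2 := by
  rw [@norm_sq_eq_re_inner 𝕜, hv.inner_sum, map_sum]
  refine Finset.sum_congr rfl fun k _ => ?_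
  rw [RCLike.conj_mul, ← RCLike.ofReal_pow, RCLike.ofReal_re]

end Conjugation

section Subunitary

variable {𝕜 E I J : Type*} [RCLike 𝕜] [NormedAddCommGroup E] [InnerProductSpace 𝕜 E]
  [Fintype I] [DecidableEq J]

theorem sum_conj_mul_of_conjTranspose_mul_self_eq_one {U : Matrix I J 𝕜}
    (hU : U.conjTranspose * U = 1) (j j' : J) :
    ∑ i, conj (U i j) * U i j' = if j = j' then 1 else 0 := by
  simpa [Matrix.mul_apply, Matrix.one_apply] using congrFun (congrFun hU j) j'

variable [Fintype J]

theorem eq_sum_smul_of_eq_sum_conj_smul {V : Type*} [AddCommGroup V] [Module 𝕜 V]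
    {U : Matrix I J 𝕜} (hU : U.conjTranspose * U = 1) {x : I → V} {y : J → V}
    (hxy : ∀ i, x i = ∑ j, conj (U i j) • y j) (j : J) : y j = ∑ i, U i j • x i := by
  simp only [hxy, Finset.smul_sum, smul_smul]
  rw [Finset.sum_comm]
  simp only [mul_comm (U _ _), ← Finset.sum_smul,
    sum_conj_mul_of_conjTranspose_mul_self_eq_one hU]
  simp

theorem sum_norm_sq_sum_conj_smul {U : Matrix I J 𝕜} (hU : U.conjTranspose * U = 1)
    (w : J → E) : ∑ i, ‖∑ j, conj (U i j) • w j‖ ^ 2 = ∑ j, ‖w j‖ ^ 2 := by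
  have hinner : ∑ i, ⟪∑ j, conj (U i j) • w j, ∑ j, conj (U i j) • w j⟫_𝕜 =
      ∑ j, ⟪w j, w j⟫_𝕜 := by
    simp only [sum_inner, inner_sum, inner_smul_left, inner_smul_right, RCLike.conj_conj,
      Finset.mul_sum]
    calc ∑ i, ∑ j, ∑ j', conj (U i j) * (U i j' * ⟪w j', w j⟫_𝕜)
        = ∑ j, ∑ j', (∑ i, conj (U i j) * U i j') * ⟪w j', w j⟫_𝕜 := by
          rw [Finset.sum_comm]
          refine Finset.sum_congr rfl fun j _ => ?_
          rw [Finset.sum_comm]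
          simp only [Finset.sum_mul, mul_assoc]
      _ = ∑ j, ⟪w j, w j⟫_𝕜 := by
          simp [sum_conj_mul_of_conjTranspose_mul_self_eq_one hU]
  simpa only [map_sum, ← @norm_sq_eq_re_inner 𝕜] using congrArg RCLike.re hinner

theorem norm_sq_sum_mul_inner_le {U : Matrix I J 𝕜} (hU : U.conjTranspose * U = 1)
    (v : I → E) (w : J → E) :
    ‖∑ i, ∑ j, U i j * ⟪w j, v i⟫_𝕜‖ ^ 2 ≤ (∑ j, ‖w j‖ ^ 2) * ∑ i, ‖v i‖ ^ 2 := by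
  have hsum : ∀ i, ∑ j, U i j * ⟪w j, v i⟫_𝕜 = ⟪∑ j, conj (U i j) • w j, v i⟫_𝕜 := fun i => by
    simp only [sum_inner, inner_smul_left, RCLike.conj_conj]
  calc ‖∑ i, ∑ j, U i j * ⟪w j, v i⟫_𝕜‖ ^ 2
      ≤ (∑ i, ‖∑ j, conj (U i j) • w j‖ * ‖v i‖) ^ 2 := by
        gcongr
        exact norm_sum_le_of_le _ fun i _ => hsum i ▸ norm_inner_le_norm _ _
    _ ≤ (∑ i, ‖∑ j, conj (U i j) • w j‖ ^ 2) * ∑ i, ‖v i‖ ^ 2 :=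
        Finset.sum_mul_sq_le_sq_mul_sq _ _ _
    _ = (∑ j, ‖w j‖ ^ 2) * ∑ i, ‖v i‖ ^ 2 := by rw [sum_norm_sq_sum_conj_smul hU]

theorem norm_sq_sum_orthonormal_le {U : Matrix I J 𝕜} (hU : U.conjTranspose * U = 1)
    {κ : J → Type*} {ι : I → Type*} [∀ j, Fintype (κ j)] [∀ i, Fintype (ι i)]
    {τ : ∀ j, κ j → E} {ρ : ∀ i, ι i → E} (hτ : ∀ j, Orthonormal 𝕜 (τ j))
    (hρ : ∀ i, Orthonormal 𝕜 (ρ i)) (α : (Σ j, κ j) → 𝕜) (β : (Σ i, ι i) → 𝕜) :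
    ‖∑ x, ∑ y, U y.1 x.1 * ⟪τ x.1 x.2, ρ y.1 y.2⟫_𝕜 * (α x * β y)‖ ^ 2 ≤
      (∑ x, ‖α x‖ ^ 2) * ∑ y, ‖β y‖ ^ 2 := by
  have hsum : ∑ x, ∑ y, U y.1 x.1 * ⟪τ x.1 x.2, ρ y.1 y.2⟫_𝕜 * (α x * β y) =
      ∑ i, ∑ j, U i j * ⟪∑ k, conj (α ⟨j, k⟩) • τ j k, ∑ l, β ⟨i, l⟩ • ρ i l⟫_𝕜 := by
    simp only [Fintype.sum_sigma, sum_inner, inner_sum, inner_smul_left, inner_smul_right,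
      RCLike.conj_conj, Finset.mul_sum]
    rw [Finset.sum_comm (s := (Finset.univ : Finset I))]
    refine Finset.sum_congr rfl fun j _ => ?_
    rw [Finset.sum_comm]
    refine Finset.sum_congr rfl fun i _ => ?_
    rw [Finset.sum_comm]
    exact Finset.sum_congr rfl fun l _ => Finset.sum_congr rfl fun k _ => by ring
  rw [hsum]
  refine (norm_sq_sum_mul_inner_le hU _ _).trans_eq ?_
  simp only [norm_sq_sum_smul_of_orthonormal (hτ _), norm_sq_sum_smul_of_orthonormal (hρ _),
    RCLike.norm_conj, Fintype.sum_sigma]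

end Subunitary

namespace SingularSystem

variable {κ ι H : Type*} [NormedAddCommGroup H] [InnerProductSpace ℂ H]

/-- The system of the adjoint operators, with right and left singular vectors exchanged. -/
def swap (s : SingularSystem κ H) : SingularSystem κ H where
  right := s.left
  left := s.right
  orthonormal_right := s.orthonormal_left
  orthonormal_left := s.orthonormal_right

/-- The subsystem indexed by a finite set, used to truncate singular value decompositions. -/
def restrict (s : SingularSystem κ H) (K : Finset κ) : SingularSystem K H where
  right k := s.right k
  left k := s.left k
  orthonormal_right := s.orthonormal_right.comp _ Subtype.val_injective
  orthonormal_left := s.orthonormal_left.comp _ Subtype.val_injective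

/-- The trace of the product of `|left k⟩⟨right k|` for `s` and `|left l⟩⟨right l|` for `r`. -/
noncomputable def overlap (s : SingularSystem κ H) (r : SingularSystem ι H) (k : κ) (l : ι) : ℂ :=
  ⟪s.right k, r.left l⟫_ℂ * ⟪r.right l, s.left k⟫_ℂ

theorem overlap_comm (s : SingularSystem κ H) (r : SingularSystem ι H) (k : κ) (l : ι) :
    s.overlap r k l = r.overlap s l k :=
  mul_comm _ _

theorem sum_norm_overlap_le_one [Fintype ι] (s : SingularSystem κ H) (r : SingularSystem ι H)
    (k : κ) : ∑ l, ‖s.overlap r k l‖ ≤ 1 := by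
  have hleft : ∑ l, ‖⟪s.right k, r.left l⟫_ℂ‖ ^ 2 ≤ 1 := by
    simpa [norm_inner_symm, s.orthonormal_right.norm_eq_one] using
      r.orthonormal_left.sum_inner_products_le (s.right k) (s := Finset.univ)
  have hright : ∑ l, ‖⟪r.right l, s.left k⟫_ℂ‖ ^ 2 ≤ 1 := by
    simpa [s.orthonormal_left.norm_eq_one] using
      r.orthonormal_right.sum_inner_products_le (s.left k) (s := Finset.univ)
  simp only [overlap, norm_mul]
  exact (Real.sum_mul_le_sqrt_mul_sqrt _ _ _).trans
    (mul_le_one₀ (Real.sqrt_le_one.2 hleft) (Real.sqrt_nonneg _) (Real.sqrt_le_one.2 hright))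

-- The singular vectors are encoded as the tensors `right k ⊗ C (left k)` for a conjugation `C`: the
-- trace pairing of Hilbert–Schmidt operators becomes the inner product of `H ⊗ H`.
theorem exists_orthonormal_inner_eq_overlap [CompleteSpace H] {I J : Type*} {κ : J → Type*}
    {ι : I → Type*} (s : ∀ j, SingularSystem (κ j) H) (r : ∀ i, SingularSystem (ι i) H) :
    ∃ (τ : ∀ j, κ j → H ⊗[ℂ] H) (ρ : ∀ i, ι i → H ⊗[ℂ] H), (∀ j, Orthonormal ℂ (τ j)) ∧
      (∀ i, Orthonormal ℂ (ρ i)) ∧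
      ∀ j k i l, ⟪τ j k, ρ i l⟫_ℂ = (s j).overlap (r i) k l := by
  obtain ⟨C, hC⟩ := exists_conjugation (𝕜 := ℂ) (E := H)
  exact ⟨fun j k => (s j).right k ⊗ₜ C ((s j).left k), fun i l => (r i).left l ⊗ₜ C ((r i).right l),
    fun j => orthonormal_tmul_conjugation hC (s j).orthonormal_right (s j).orthonormal_left,
    fun i => orthonormal_tmul_conjugation hC (r i).orthonormal_left (r i).orthonormal_right,
    fun j k i l => by rw [TensorProduct.inner_tmul, hC, overlap]⟩

end SingularSystem

theorem HasSVD.hasSum_mul_overlap {κ ι H : Type*} [NormedAddCommGroup H] [InnerProductSpace ℂ H]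
    {T : H →L[ℂ] H} {σ : κ → ℝ} {s : SingularSystem κ H} (hT : HasSVD T σ s)
    (r : SingularSystem ι H) (l : ι) :
    HasSum (fun k => (σ k : ℂ) * s.overlap r k l) ⟪r.right l, T (r.left l)⟫_ℂ :=
  hT.hasSum_inner (r.left l) (r.right l)

section TwistedOverlap

variable {H I J : Type*} [NormedAddCommGroup H] [InnerProductSpace ℂ H] {κ : J → Type*}
  {ι : I → Type*} {U : Matrix I J ℂ} {s : ∀ j, SingularSystem (κ j) H}
  {r : ∀ i, SingularSystem (ι i) H}

/-- The kernel of the bilinear form `∑ᵢⱼ uᵢⱼ Tr (Aⱼ Bᵢ)` in the singular value coordinates of the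
operators `Aⱼ`, `Bᵢ` with singular systems `s j`, `r i`. -/
noncomputable def twistedOverlap (U : Matrix I J ℂ) (s : ∀ j, SingularSystem (κ j) H)
    (r : ∀ i, SingularSystem (ι i) H) (x : Σ j, κ j) (y : Σ i, ι i) : ℂ :=
  U y.1 x.1 * (s x.1).overlap (r y.1) x.2 y.2

theorem twistedOverlap_transpose (x : Σ j, κ j) (y : Σ i, ι i) :
    twistedOverlap U.transpose r s y x = twistedOverlap U s r x y := by
  rw [twistedOverlap, twistedOverlap, SingularSystem.overlap_comm, Matrix.transpose_apply]

theorem sum_norm_twistedOverlap_le [∀ i, Fintype (ι i)] (x : Σ j, κ j) (i : I) :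
    ∑ l, ‖twistedOverlap U s r x ⟨i, l⟩‖ ≤ ‖U i x.1‖ := by
  simp only [twistedOverlap, norm_mul, ← Finset.mul_sum]
  exact mul_le_of_le_one_right (norm_nonneg _) ((s x.1).sum_norm_overlap_le_one (r i) x.2)

theorem norm_sq_sum_twistedOverlap_le [CompleteSpace H] [Fintype I] [Fintype J] [DecidableEq J]
    [∀ j, Fintype (κ j)] [∀ i, Fintype (ι i)] (hU : U.conjTranspose * U = 1)
    (α : (Σ j, κ j) → ℂ) (β : (Σ i, ι i) → ℂ) :
    ‖∑ x, ∑ y, twistedOverlap U s r x y * (α x * β y)‖ ^ 2 ≤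
      (∑ x, ‖α x‖ ^ 2) * ∑ y, ‖β y‖ ^ 2 := by
  obtain ⟨τ, ρ, hτ, hρ, hτρ⟩ := SingularSystem.exists_orthonormal_inner_eq_overlap s r
  simpa only [twistedOverlap, hτρ] using norm_sq_sum_orthonormal_le hU hτ hρ α β

end TwistedOverlap

section ThreeLines

/-- The analytic path `z ↦ a ^ (1 - z) * b ^ z` from `a` at `z = 0` to `b` at `z = 1`. -/
noncomputable def geometricPath (a b : ℝ) (z : ℂ) : ℂ :=
  (a : ℂ) ^ (1 - z) * (b : ℂ) ^ z

theorem geometricPath_ofReal {a b : ℝ} (ha : 0 ≤ a) (hb : 0 ≤ b) (θ : ℝ) :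
    geometricPath a b θ = ((a ^ (1 - θ) * b ^ θ : ℝ) : ℂ) := by
  rw [geometricPath, Complex.ofReal_mul, Complex.ofReal_cpow ha, Complex.ofReal_cpow hb]
  push_cast
  rfl

theorem norm_geometricPath {a b : ℝ} (ha : 0 < a) (hb : 0 < b) (z : ℂ) :
    ‖geometricPath a b z‖ = a ^ (1 - z.re) * b ^ z.re := by
  rw [geometricPath, norm_mul, Complex.norm_cpow_eq_rpow_re_of_pos ha,
    Complex.norm_cpow_eq_rpow_re_of_pos hb, Complex.sub_re, Complex.one_re]

theorem differentiable_geometricPath {a b : ℝ} (ha : 0 < a) (hb : 0 < b) :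
    Differentiable ℂ (geometricPath a b) := by
  have ha' : (a : ℂ) ≠ 0 := Complex.ofReal_ne_zero.2 ha.ne'
  have hb' : (b : ℂ) ≠ 0 := Complex.ofReal_ne_zero.2 hb.ne'
  intro z
  unfold geometricPath
  fun_prop (disch := simp [ha', hb'])

variable {κ υ : Type*} [Fintype κ] [Fintype υ] {c : κ → υ → ℂ} {a₀ a₁ : κ → ℝ} {b₀ b₁ : υ → ℝ}

theorem bddAbove_norm_sum_geometricPath (ha₀ : ∀ k, 0 < a₀ k) (ha₁ : ∀ k, 0 < a₁ k)
    (hb₀ : ∀ y, 0 < b₀ y) (hb₁ : ∀ y, 0 < b₁ y) :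
    BddAbove ((norm ∘ fun z => ∑ k, ∑ y, c k y *
      (geometricPath (a₀ k) (a₁ k) z * geometricPath (b₀ y) (b₁ y) z)) ''
        Complex.HadamardThreeLines.verticalClosedStrip 0 1) := by
  let G : ℝ → ℝ := fun t => ∑ k, ∑ y, ‖c k y‖ *
    ((a₀ k ^ (1 - t) * a₁ k ^ t) * (b₀ y ^ (1 - t) * b₁ y ^ t))
  have hG : Continuous G := by
    refine continuous_finsetSum _ fun k _ => continuous_finsetSum _ fun y _ => ?_
    have := (ha₀ k).ne'
    have := (ha₁ k).ne'
    have := (hb₀ y).ne'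
    have := (hb₁ y).ne'
    fun_prop (disch := simp_all)
  obtain ⟨R, hR⟩ := (isCompact_Icc (a := (0 : ℝ)) (b := 1)).bddAbove_image hG.continuousOn
  refine ⟨R, ?_⟩
  rintro _ ⟨z, hz, rfl⟩
  refine (norm_sum_le_of_le _ fun k _ => norm_sum_le_of_le _ fun y _ => ?_).trans
    (hR (Set.mem_image_of_mem G hz))
  rw [norm_mul, norm_mul, norm_geometricPath (ha₀ k) (ha₁ k), norm_geometricPath (hb₀ y) (hb₁ y)]

theorem norm_sum_mul_le_interpolation (ha₀ : ∀ k, 0 < a₀ k) (ha₁ : ∀ k, 0 < a₁ k)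
    (hb₀ : ∀ y, 0 < b₀ y) (hb₁ : ∀ y, 0 < b₁ y) {R₀ R₁ : ℝ}
    (h₀ : ∀ (α : κ → ℂ) (β : υ → ℂ), (∀ k, ‖α k‖ = a₀ k) → (∀ y, ‖β y‖ = b₀ y) →
      ‖∑ k, ∑ y, c k y * (α k * β y)‖ ≤ R₀)
    (h₁ : ∀ (α : κ → ℂ) (β : υ → ℂ), (∀ k, ‖α k‖ = a₁ k) → (∀ y, ‖β y‖ = b₁ y) →
      ‖∑ k, ∑ y, c k y * (α k * β y)‖ ≤ R₁)
    {θ : ℝ} (hθ : θ ∈ Set.Icc 0 1) :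
    ‖∑ k, ∑ y, c k y * (((a₀ k ^ (1 - θ) * a₁ k ^ θ : ℝ) : ℂ) *
      ((b₀ y ^ (1 - θ) * b₁ y ^ θ : ℝ) : ℂ))‖ ≤ R₀ ^ (1 - θ) * R₁ ^ θ := by
  let F : ℂ → ℂ := fun z => ∑ k, ∑ y, c k y *
    (geometricPath (a₀ k) (a₁ k) z * geometricPath (b₀ y) (b₁ y) z)
  have hF : Differentiable ℂ F :=
    .fun_sum fun k _ => .fun_sum fun y _ => .const_mul
      ((differentiable_geometricPath (ha₀ k) (ha₁ k)).mul
        (differentiable_geometricPath (hb₀ y) (hb₁ y))) _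
  have hF₀ : ∀ z ∈ Complex.re ⁻¹' {(0 : ℝ)}, ‖F z‖ ≤ R₀ := fun z (hz : z.re = 0) =>
    h₀ _ _ (fun k => by simp [norm_geometricPath (ha₀ k) (ha₁ k), hz])
      fun y => by simp [norm_geometricPath (hb₀ y) (hb₁ y), hz]
  have hF₁ : ∀ z ∈ Complex.re ⁻¹' {(1 : ℝ)}, ‖F z‖ ≤ R₁ := fun z (hz : z.re = 1) =>
    h₁ _ _ (fun k => by simp [norm_geometricPath (ha₀ k) (ha₁ k), hz])
      fun y => by simp [norm_geometricPath (hb₀ y) (hb₁ y), hz]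
  have hinterp := Complex.HadamardThreeLines.norm_le_interp_of_mem_verticalClosedStrip'
    (z := (θ : ℂ)) zero_lt_one hθ hF.diffContOnCl
    (bddAbove_norm_sum_geometricPath ha₀ ha₁ hb₀ hb₁) hF₀ hF₁
  simpa only [F, geometricPath_ofReal (ha₀ _).le (ha₁ _).le, geometricPath_ofReal (hb₀ _).le
    (hb₁ _).le, Complex.ofReal_re, sub_zero, div_one] using hinterp

end ThreeLines

section MixedNorm

theorem rpow_half_sq {x : ℝ} (hx : 0 ≤ x) (y : ℝ) : (x ^ (y / 2)) ^ 2 = x ^ y := by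
  rw [← Real.rpow_mul_natCast hx]
  simp

theorem rpow_sub_one_mul_self {x r : ℝ} (hx : 0 ≤ x) (hr : r ≠ 0) : x ^ (r - 1) * x = x ^ r := by
  rw [← Real.rpow_add_one' hx (by simpa), sub_add_cancel]

theorem sum_sq_rpow_mul_rpow_half {υ : Type*} [Fintype υ] (p : ℝ) {r : ℝ} (hr : r ≠ 0)
    {b : υ → ℝ} (hb : ∀ l, 0 < b l) :
    ∑ l, ((∑ m, b m ^ p) ^ ((r - 1) / 2) * b l ^ (p / 2)) ^ 2 = (∑ l, b l ^ p) ^ r := by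
  have hS : 0 ≤ ∑ l, b l ^ p := Finset.sum_nonneg fun l _ => Real.rpow_nonneg (hb l).le _
  simp only [mul_pow, rpow_half_sq hS, rpow_half_sq (hb _).le, ← Finset.mul_sum]
  exact rpow_sub_one_mul_self hS hr

theorem rpow_mul_rpow_interpolation {x : ℝ} (hx : 0 < x) (y z θ : ℝ) :
    (x ^ y) ^ (1 - θ) * (x ^ z) ^ θ = x ^ (y * (1 - θ) + z * θ) := by
  rw [← Real.rpow_mul hx.le, ← Real.rpow_mul hx.le, ← Real.rpow_add hx]

variable {κ I : Type*} [Fintype κ] [Fintype I] {ι : I → Type*} [∀ i, Fintype (ι i)]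
  {c : κ → (Σ i, ι i) → ℂ} {M : ℝ}

theorem norm_sum_mul_le_of_sum_norm_le (hc : ∀ k i, ∑ l, ‖c k ⟨i, l⟩‖ ≤ M) {a : κ → ℝ}
    {S : I → ℝ} (hS : ∀ i, 0 ≤ S i) {α : κ → ℂ} {β : (Σ i, ι i) → ℂ}
    (hα : ∀ k, ‖α k‖ = a k) (hβ : ∀ y, ‖β y‖ = S y.1) :
    ‖∑ k, ∑ y, c k y * (α k * β y)‖ ≤ M * ((∑ k, a k) * ∑ i, S i) := by
  calc ‖∑ k, ∑ y, c k y * (α k * β y)‖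
      ≤ ∑ k, ∑ y : Σ i, ι i, ‖c k y‖ * (a k * S y.1) :=
        norm_sum_le_of_le _ fun k _ => norm_sum_le_of_le _ fun y _ => by
          rw [norm_mul, norm_mul, hα, hβ]
    _ = ∑ k, ∑ i, (∑ l, ‖c k ⟨i, l⟩‖) * (a k * S i) := by
        simp only [Fintype.sum_sigma, Finset.sum_mul]
    _ ≤ ∑ k, ∑ i, M * (a k * S i) := by
        gcongr with k _ i _
        · exact mul_nonneg (hα k ▸ norm_nonneg _) (hS i)
        · exact hc k i
    _ = M * ((∑ k, a k) * ∑ i, S i) := by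
        rw [Finset.sum_mul_sum]
        simp only [Finset.mul_sum]

theorem dualPath_eq_self {p q a : ℝ} (hpq : p.HolderConjugate q) (ha : 0 < a) :
    (a ^ q) ^ (1 - 2 / p) * (a ^ (q / 2)) ^ (2 / p) = a := by
  have hexp : q * (1 - 2 / p) + q / 2 * (2 / p) = 1 := by
    linear_combination -hpq.symm.div_conj_eq_sub_one
  rw [rpow_mul_rpow_interpolation ha, hexp, Real.rpow_one]

theorem mixedNormPath_eq_self {p q S b : ℝ} (hpq : p.HolderConjugate q) (hS : 0 < S)
    (hb : 0 < b) :
    (S ^ (q / p)) ^ (1 - 2 / p) * (S ^ ((q / p - 1) / 2) * b ^ (p / 2)) ^ (2 / p) = b := by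
  have hexp : q / p * (1 - 2 / p) + (q / p - 1) / 2 * (2 / p) = 0 := by
    linear_combination -(1 / p) * hpq.symm.div_conj_eq_sub_one
  rw [Real.mul_rpow (by positivity) (by positivity), ← mul_assoc, rpow_mul_rpow_interpolation hS,
    hexp, Real.rpow_zero, one_mul, ← Real.rpow_mul hb.le, ← inv_div p 2,
    mul_inv_cancel₀ (div_ne_zero hpq.ne_zero two_ne_zero), Real.rpow_one]

theorem norm_sum_mul_le_mixedNorm (hc : ∀ k i, ∑ l, ‖c k ⟨i, l⟩‖ ≤ M)
    (hc2 : ∀ (α : κ → ℂ) (β : (Σ i, ι i) → ℂ),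
      ‖∑ k, ∑ y, c k y * (α k * β y)‖ ^ 2 ≤ (∑ k, ‖α k‖ ^ 2) * ∑ y, ‖β y‖ ^ 2)
    (hM : 0 ≤ M) {p q : ℝ} (hpq : p.HolderConjugate q) (hp : 2 ≤ p)
    {a : κ → ℝ} {b : (Σ i, ι i) → ℝ} (ha : ∀ k, 0 < a k) (hb : ∀ y, 0 < b y) :
    ‖∑ k, ∑ y, c k y * (a k * b y)‖ ≤ M ^ (1 - 2 / p) *
      ((∑ k, a k ^ q) * ∑ i, (∑ l, b ⟨i, l⟩ ^ p) ^ (q / p)) ^ (1 / q) := by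
  -- The endpoint `z = 0` is `p = ∞`, the endpoint `z = 1` is `p = 2`, and `1 / p = (2 / p) / 2`.
  have hp0 := hpq.pos
  have hθ : 2 / p ≤ 1 := (div_le_one hp0).2 hp
  set S : I → ℝ := fun i => ∑ l, b ⟨i, l⟩ ^ p
  have hS : ∀ i, 0 ≤ S i := fun i => Finset.sum_nonneg fun l _ => Real.rpow_nonneg (hb _).le _
  have hSpos : ∀ y : Σ i, ι i, 0 < S y.1 := fun y =>
    Finset.sum_pos (fun l _ => Real.rpow_pos_of_pos (hb _) _) ⟨y.2, Finset.mem_univ _⟩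
  set R : ℝ := (∑ k, a k ^ q) * ∑ i, S i ^ (q / p)
  have hR : 0 ≤ R := mul_nonneg (Finset.sum_nonneg fun k _ => Real.rpow_nonneg (ha k).le _)
    (Finset.sum_nonneg fun i _ => Real.rpow_nonneg (hS i) _)
  have key := norm_sum_mul_le_interpolation (c := c) (θ := 2 / p)
    (fun k => Real.rpow_pos_of_pos (ha k) q) (fun k => Real.rpow_pos_of_pos (ha k) (q / 2))
    (fun y => Real.rpow_pos_of_pos (hSpos y) (q / p))
    (fun y => mul_pos (Real.rpow_pos_of_pos (hSpos y) ((q / p - 1) / 2))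
      (Real.rpow_pos_of_pos (hb y) (p / 2)))
    (fun α β hα hβ => norm_sum_mul_le_of_sum_norm_le hc
      (fun i => Real.rpow_nonneg (hS i) (q / p)) hα hβ)
    (R₁ := R ^ (1 / 2 : ℝ)) (fun α β hα₁ hβ₁ => ?_) ⟨by positivity, hθ⟩
  · have hb' := fun y => mixedNormPath_eq_self hpq (hSpos y) (hb y)
    simp only [dualPath_eq_self hpq (ha _), hb'] at key
    refine key.trans_eq ?_
    rw [Real.mul_rpow hM hR, mul_assoc, ← Real.rpow_mul hR,
      ← Real.rpow_add_of_nonneg hR (sub_nonneg.2 hθ) (by positivity)]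
    congr 2
    linear_combination -hpq.inv_add_inv_eq_one
  · rw [← Real.sqrt_eq_rpow]
    refine Real.le_sqrt_of_sq_le ((hc2 α β).trans_eq ?_)
    have hr : q / p ≠ 0 := (div_pos hpq.symm.pos hp0).ne'
    simp only [hα₁, hβ₁, rpow_half_sq (ha _).le, Fintype.sum_sigma, S, R,
      sum_sq_rpow_mul_rpow_half p hr fun l => hb ⟨_, l⟩]

end MixedNorm

section Truncation

variable {I J : Type*} {κ : J → Type*}

theorem tendsto_sum_pi_finset {R : Type*} [AddCommMonoid R] [TopologicalSpace R] {j : J}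
    {g : κ j → R} {c : R} (hg : HasSum g c) :
    Tendsto (fun K : ∀ j, Finset (κ j) => ∑ k : K j, g k) (Filter.pi fun _ => atTop) (𝓝 c) := by
  have hg' : Tendsto (fun K : Finset (κ j) => ∑ k ∈ K, g k) atTop (𝓝 c) := by
    simpa [HasSum] using hg
  simp only [Finset.univ_eq_attach, Finset.sum_attach]
  exact hg'.comp (tendsto_eval_pi _ j)

theorem sum_coe_finset_le_hasSum {υ : Type*} {g : υ → ℝ} {c : ℝ} (hg₀ : ∀ k, 0 ≤ g k)
    (hg : HasSum g c) (K : Finset υ) : ∑ k : K, g k ≤ c := by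
  rw [Finset.sum_coe_sort K g]
  exact sum_le_hasSum K (fun k _ => hg₀ k) hg

theorem tendsto_sum_sigma_finset {R : Type*} [AddCommMonoid R] [TopologicalSpace R]
    [ContinuousAdd R] [Fintype J] {g : ∀ j, κ j → R} {c : J → R} (hg : ∀ j, HasSum (g j) (c j)) :
    Tendsto (fun K : ∀ j, Finset (κ j) => ∑ x : Σ j, K j, g x.1 x.2) (Filter.pi fun _ => atTop)
      (𝓝 (∑ j, c j)) := by
  simp only [Fintype.sum_sigma]
  exact tendsto_finsetSum _ fun j _ => tendsto_sum_pi_finset (hg j)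

variable {H : Type*} [NormedAddCommGroup H] [InnerProductSpace ℂ H] {ι : I → Type*}
  [Fintype I] [Fintype J] [∀ i, Fintype (ι i)] {U : Matrix I J ℂ}

theorem norm_sum_inner_le_of_truncations {T : J → H →L[ℂ] H} {σ : ∀ j, κ j → ℝ}
    {s : ∀ j, SingularSystem (κ j) H} (hT : ∀ j, HasSVD (T j) (σ j) (s j))
    {r : ∀ i, SingularSystem (ι i) H} {b : (Σ i, ι i) → ℝ} {R : ℝ}
    (hR : ∀ K : ∀ j, Finset (κ j), ‖∑ x : Σ j, K j, ∑ y,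
      twistedOverlap U (fun j => (s j).restrict (K j)) r x y * (σ x.1 x.2 * b y)‖ ≤ R) :
    ‖∑ y, b y * ⟪(r y.1).right y.2, (∑ j, U y.1 j • T j) ((r y.1).left y.2)⟫_ℂ‖ ≤ R := by
  have hsum : ∀ j, HasSum (fun k => ∑ y, twistedOverlap U s r ⟨j, k⟩ y * (σ j k * b y))
      (∑ y, U y.1 j * b y * ⟪(r y.1).right y.2, T j ((r y.1).left y.2)⟫_ℂ) := fun j =>
    hasSum_sum fun y _ => by
      simpa only [twistedOverlap, mul_assoc, mul_comm, mul_left_comm] using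
        ((hT j).hasSum_mul_overlap (r y.1) y.2).mul_left (U y.1 j * b y)
  have hpair : ∑ y, b y * ⟪(r y.1).right y.2, (∑ j, U y.1 j • T j) ((r y.1).left y.2)⟫_ℂ =
      ∑ j, ∑ y, U y.1 j * b y * ⟪(r y.1).right y.2, T j ((r y.1).left y.2)⟫_ℂ := by
    rw [Finset.sum_comm]
    refine Finset.sum_congr rfl fun y _ => ?_
    simp only [sum_apply, smul_apply, inner_sum, inner_smul_right,
      Finset.mul_sum]
    exact Finset.sum_congr rfl fun j _ => by ring
  rw [hpair]
  exact le_of_tendsto (tendsto_sum_sigma_finset hsum).norm (.of_forall hR)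

end Truncation

section Pairing

variable {H I J : Type*} [NormedAddCommGroup H] [InnerProductSpace ℂ H] [CompleteSpace H]
  [Fintype I] [Fintype J] [DecidableEq J] {U : Matrix I J ℂ} {M p q : ℝ}

theorem norm_sum_twistedOverlap_le {κ : J → Type*} {ι : I → Type*} [∀ j, Fintype (κ j)]
    [∀ i, Fintype (ι i)] (hU : U.conjTranspose * U = 1) (hM : 0 ≤ M) (hUM : ∀ i j, ‖U i j‖ ≤ M)
    (hpq : p.HolderConjugate q) (hp : 2 ≤ p) (s : ∀ j, SingularSystem (κ j) H)
    (r : ∀ i, SingularSystem (ι i) H) {a : (Σ j, κ j) → ℝ} {b : (Σ i, ι i) → ℝ}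
    (ha : ∀ x, 0 < a x) (hb : ∀ y, 0 < b y) :
    ‖∑ x, ∑ y, twistedOverlap U s r x y * (a x * b y)‖ ≤ M ^ (1 - 2 / p) *
      ((∑ x, a x ^ q) * ∑ i, (∑ l, b ⟨i, l⟩ ^ p) ^ (q / p)) ^ (1 / q) :=
  norm_sum_mul_le_mixedNorm (fun x i => (sum_norm_twistedOverlap_le x i).trans (hUM i x.1))
    (norm_sq_sum_twistedOverlap_le hU) hM hpq hp ha hb

theorem norm_sum_inner_le_of_le_two {ι : I → Type*} [∀ i, Fintype (ι i)]
    (hU : U.conjTranspose * U = 1) (hM : 0 ≤ M) (hUM : ∀ i j, ‖U i j‖ ≤ M)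
    (hpq : p.HolderConjugate q) (hp : p ≤ 2) {Y : J → H →L[ℂ] H} (hY : ∀ j, MemSchatten p (Y j))
    (r : ∀ i, SingularSystem (ι i) H) {b : (Σ i, ι i) → ℝ} (hb : ∀ y, 0 < b y) :
    ‖∑ y, b y * ⟪(r y.1).right y.2, (∑ j, U y.1 j • Y j) ((r y.1).left y.2)⟫_ℂ‖ ≤
      M ^ (1 - 2 / q) * ((∑ j, schattenNorm p (Y j) ^ p) *
        ∑ i, (∑ l, b ⟨i, l⟩ ^ q) ^ (p / q)) ^ (1 / p) := by
  have hq : 2 ≤ q := by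
    rw [hpq.conjugate_eq, le_div_iff₀ hpq.sub_one_pos]
    linarith
  have hp0 := hpq.pos
  choose κ σ s hYσ hσ using fun j => (hY j).exists_hasSVD hpq.ne_zero
  refine norm_sum_inner_le_of_truncations hYσ fun K => ?_
  refine (norm_sum_twistedOverlap_le hU hM hUM hpq.symm hq
    (fun j => (s j).restrict (K j)) r (fun x => (hYσ x.1).pos x.2) hb).trans ?_
  have hσ₀ : ∀ j k, 0 ≤ σ j k ^ p := fun j k => Real.rpow_nonneg ((hYσ j).pos k).le p
  have hb₀ : ∀ i, 0 ≤ ∑ l, b ⟨i, l⟩ ^ q := fun i =>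
    Finset.sum_nonneg fun l _ => Real.rpow_nonneg (hb _).le q
  gcongr
  · exact mul_nonneg (Finset.sum_nonneg fun x _ => hσ₀ x.1 x.2)
      (Finset.sum_nonneg fun i _ => Real.rpow_nonneg (hb₀ i) _)
  · exact Finset.sum_nonneg fun i _ => Real.rpow_nonneg (hb₀ i) _
  · rw [Fintype.sum_sigma]
    exact Finset.sum_le_sum fun j _ => sum_coe_finset_le_hasSum (hσ₀ j) (hσ j) (K j)

theorem norm_sum_inner_le_of_two_le {κ : J → Type*} [∀ j, Fintype (κ j)]
    (hU : U.conjTranspose * U = 1) (hM : 0 ≤ M) (hUM : ∀ i j, ‖U i j‖ ≤ M)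
    (hpq : p.HolderConjugate q) (hp : 2 ≤ p) {X : I → H →L[ℂ] H} (hX : ∀ i, MemSchatten p (X i))
    (s : ∀ j, SingularSystem (κ j) H) {a : (Σ j, κ j) → ℝ} (ha : ∀ x, 0 < a x) :
    ‖∑ x, a x * ⟪(s x.1).right x.2, (∑ i, U i x.1 • X i) ((s x.1).left x.2)⟫_ℂ‖ ≤
      M ^ (1 - 2 / p) * ((∑ x, a x ^ q) * ∑ i, schattenNorm p (X i) ^ q) ^ (1 / q) := by
  have hq0 := hpq.symm.pos
  have hqp0 : 0 ≤ q / p := div_nonneg hq0.le hpq.nonneg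
  choose ι σ r hXσ hσ using fun i => (hX i).exists_hasSVD hpq.ne_zero
  refine norm_sum_inner_le_of_truncations (U := U.transpose) hXσ fun L => ?_
  have hσ₀ : ∀ i l, 0 ≤ σ i l ^ p := fun i l => Real.rpow_nonneg ((hXσ i).pos l).le p
  have hS : ∀ i, 0 ≤ ∑ l : L i, σ i l ^ p := fun i => Finset.sum_nonneg fun l _ => hσ₀ i l
  have ha₀ : 0 ≤ ∑ x, a x ^ q := Finset.sum_nonneg fun x _ => Real.rpow_nonneg (ha x).le q
  have hXq : ∀ i, (∑ l : L i, σ i l ^ p) ^ (q / p) ≤ schattenNorm p (X i) ^ q := fun i =>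
    calc (∑ l : L i, σ i l ^ p) ^ (q / p)
        ≤ (schattenNorm p (X i) ^ p) ^ (q / p) :=
          Real.rpow_le_rpow (hS i) (sum_coe_finset_le_hasSum (hσ₀ i) (hσ i) (L i)) hqp0
      _ = schattenNorm p (X i) ^ q := schattenNorm_rpow_rpow_div hpq.ne_zero q (X i)
  have hbound := norm_sum_twistedOverlap_le hU hM hUM hpq hp s (fun i => (r i).restrict (L i)) ha
    fun y => (hXσ y.1).pos y.2
  rw [Finset.sum_comm]
  simp only [twistedOverlap_transpose, mul_comm ((σ _ _ : ℝ) : ℂ)]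
  refine hbound.trans ?_
  gcongr
  · exact mul_nonneg ha₀ (Finset.sum_nonneg fun i _ => Real.rpow_nonneg (hS i) _)
  · exact hXq _

end Pairing

section Duality

theorem le_rpow_mul_rpow_of_le_mul_rpow {p q C A N : ℝ} (hpq : p.HolderConjugate q) (hC : 0 ≤ C)
    (hA : 0 ≤ A) (hN : 0 ≤ N) (h : N ≤ C * (A * N) ^ (1 / p)) : N ≤ C ^ q * A ^ (q / p) := by
  rcases hN.eq_or_lt with rfl | hN'
  · positivity
  have hAN := mul_nonneg hA hN
  refine le_of_mul_le_mul_right ?_ (Real.rpow_pos_of_pos hN' (q / p))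
  calc N * N ^ (q / p)
      = N ^ q := by
        rw [hpq.symm.div_conj_eq_sub_one, mul_comm, rpow_sub_one_mul_self hN hpq.symm.ne_zero]
    _ ≤ (C * (A * N) ^ (1 / p)) ^ q := Real.rpow_le_rpow hN h hpq.symm.nonneg
    _ = C ^ q * A ^ (q / p) * N ^ (q / p) := by
        rw [Real.mul_rpow hC (Real.rpow_nonneg hAN _), ← Real.rpow_mul hAN, one_div_mul_eq_div,
          Real.mul_rpow hA hN, mul_assoc]

/-- The norming functional of the vector `x` of `ℓᵖ`, scaled so that its `ℓ^q` norm is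
`‖x‖_p ^ (q - 1)`. -/
noncomputable def dualWeight {υ : Type*} [Fintype υ] (p q : ℝ) (x : υ → ℝ) (l : υ) : ℝ :=
  (∑ m, x m ^ p) ^ (q / p - 1) * x l ^ (p - 1)

section DualWeight

variable {υ : Type*} [Fintype υ] {p q : ℝ} {x : υ → ℝ}

theorem dualWeight_pos (hx : ∀ l, 0 < x l) (l : υ) : 0 < dualWeight p q x l :=
  mul_pos (Real.rpow_pos_of_pos (Finset.sum_pos (fun m _ => Real.rpow_pos_of_pos (hx m) p)
    ⟨l, Finset.mem_univ l⟩) _) (Real.rpow_pos_of_pos (hx l) _)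

theorem sum_dualWeight_mul (hpq : p.HolderConjugate q) (hx : ∀ l, 0 ≤ x l) :
    ∑ l, dualWeight p q x l * x l = (∑ l, x l ^ p) ^ (q / p) := by
  simp only [dualWeight, mul_assoc, rpow_sub_one_mul_self (hx _) hpq.ne_zero, ← Finset.mul_sum]
  exact rpow_sub_one_mul_self (Finset.sum_nonneg fun l _ => Real.rpow_nonneg (hx l) p)
    (div_pos hpq.symm.pos hpq.pos).ne'

theorem sum_dualWeight_rpow (hpq : p.HolderConjugate q) (hx : ∀ l, 0 ≤ x l) :
    (∑ l, dualWeight p q x l ^ q) ^ (p / q) = (∑ l, x l ^ p) ^ (q / p) := by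
  have hS : 0 ≤ ∑ l, x l ^ p := Finset.sum_nonneg fun l _ => Real.rpow_nonneg (hx l) p
  have hexp : ((q / p - 1) * q + 1) * (p / q) = q / p := by
    rw [hpq.div_conj_eq_sub_one, hpq.symm.div_conj_eq_sub_one]
    linear_combination (q - 2) * hpq.sub_one_mul_conj + hpq.mul_eq_add
  have hne : (q / p - 1) * q + 1 ≠ 0 := fun h =>
    (div_pos hpq.symm.pos hpq.pos).ne (by rw [← hexp, h, zero_mul])
  simp only [dualWeight, Real.mul_rpow (Real.rpow_nonneg hS _) (Real.rpow_nonneg (hx _) _),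
    ← Real.rpow_mul (hx _), hpq.sub_one_mul_conj, ← Finset.mul_sum]
  rw [← Real.rpow_mul hS, ← Real.rpow_add_one' hS hne, ← Real.rpow_mul hS, hexp]

theorem sum_sigma_dualWeight_mul {I : Type*} {ι : I → Type*} [Fintype I] [∀ i, Fintype (ι i)]
    {x : ∀ i, ι i → ℝ} (hpq : p.HolderConjugate q) (hx : ∀ i l, 0 ≤ x i l) :
    ∑ y : Σ i, ι i, dualWeight p q (x y.1) y.2 * x y.1 y.2 =
      ∑ i, (∑ l, x i l ^ p) ^ (q / p) := by
  simp only [Fintype.sum_sigma, sum_dualWeight_mul hpq (hx _)]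

end DualWeight

variable {H I J : Type*} [NormedAddCommGroup H] [InnerProductSpace ℂ H]

theorem sum_mul_inner_left_apply_right {κ : J → Type*} {Y : J → H →L[ℂ] H} {σ : ∀ j, κ j → ℝ}
    {s : ∀ j, SingularSystem (κ j) H} (hY : ∀ j, HasSVD (Y j) (σ j) (s j)) [Fintype J]
    (K : ∀ j, Finset (κ j)) (a : (Σ j, K j) → ℝ) :
    ∑ x : Σ j, K j, (a x : ℂ) * ⟪((s x.1).swap.restrict (K x.1)).right x.2,
      Y x.1 (((s x.1).swap.restrict (K x.1)).left x.2)⟫_ℂ =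
        ((∑ x, a x * σ x.1 x.2 : ℝ) : ℂ) := by
  push_cast
  exact Finset.sum_congr rfl fun x _ => congrArg _ ((hY x.1).inner_left_apply_right x.2)

variable [CompleteSpace H] [Fintype I] [Fintype J] [DecidableEq J] {U : Matrix I J ℂ} {M p q : ℝ}
  {X : I → H →L[ℂ] H} {Y : J → H →L[ℂ] H}

theorem sum_schattenNorm_rpow_le (hU : U.conjTranspose * U = 1) (hM : 0 ≤ M)
    (hUM : ∀ i j, ‖U i j‖ ≤ M) (hpq : p.HolderConjugate q) (hp : p ≤ 2)
    (hX : ∀ i, MemSchatten p (X i)) (hY : ∀ j, MemSchatten p (Y j))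
    (hXY : ∀ i, X i = ∑ j, U i j • Y j) :
    ∑ i, schattenNorm p (X i) ^ q ≤
      M ^ (q / p - 1) * (∑ j, schattenNorm p (Y j) ^ p) ^ (q / p) := by
  choose ι σ s hXσ hσ using fun i => (hX i).exists_hasSVD hpq.ne_zero
  have hqp : 0 < q / p := div_pos hpq.symm.pos hpq.pos
  have hlim := tendsto_finsetSum Finset.univ fun i _ =>
    (tendsto_sum_pi_finset (hσ i)).rpow_const (.inr hqp.le)
  simp only [schattenNorm_rpow_rpow_div hpq.ne_zero] at hlim
  refine le_of_tendsto hlim (.of_forall fun L => ?_)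
  let x : ∀ i, L i → ℝ := fun i l => σ i l
  have hx : ∀ i l, 0 < x i l := fun i l => (hXσ i).pos l
  have hx₀ : ∀ i l, 0 ≤ x i l := fun i l => (hx i l).le
  have hN : 0 ≤ ∑ i, (∑ l, x i l ^ p) ^ (q / p) := Finset.sum_nonneg fun i _ =>
    Real.rpow_nonneg (Finset.sum_nonneg fun l _ => Real.rpow_nonneg (hx₀ i l) p) _
  have hA : 0 ≤ ∑ j, schattenNorm p (Y j) ^ p :=
    Finset.sum_nonneg fun j _ => Real.rpow_nonneg (schattenNorm_nonneg p _) p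
  have htest := norm_sum_inner_le_of_le_two hU hM hUM hpq hp hY
    (fun i => (s i).swap.restrict (L i)) (b := fun y => dualWeight p q (x y.1) y.2)
    fun y => dualWeight_pos (hx y.1) y.2
  simp only [← hXY, sum_dualWeight_rpow hpq (hx₀ _)] at htest
  rw [sum_mul_inner_left_apply_right hXσ, sum_sigma_dualWeight_mul hpq hx₀,
    Complex.norm_of_nonneg hN] at htest
  have hexp : (1 - 2 / q) * q = q / p - 1 := by
    rw [sub_mul, div_mul_cancel₀ _ hpq.symm.ne_zero, hpq.symm.div_conj_eq_sub_one]
    ring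
  refine (le_rpow_mul_rpow_of_le_mul_rpow hpq (Real.rpow_nonneg hM _) hA hN htest).trans_eq ?_
  rw [← Real.rpow_mul hM, hexp]

theorem le_sum_schattenNorm_rpow (hU : U.conjTranspose * U = 1) (hM : 0 ≤ M)
    (hUM : ∀ i j, ‖U i j‖ ≤ M) (hpq : p.HolderConjugate q) (hp : 2 ≤ p)
    (hX : ∀ i, MemSchatten p (X i)) (hY : ∀ j, MemSchatten p (Y j))
    (hYX : ∀ j, Y j = ∑ i, U i j • X i) :
    M ^ (q / p - 1) * (∑ j, schattenNorm p (Y j) ^ p) ^ (q / p) ≤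
      ∑ i, schattenNorm p (X i) ^ q := by
  choose κ σ s hYσ hσ using fun j => (hY j).exists_hasSVD hpq.ne_zero
  have hqp : 0 < q / p := div_pos hpq.symm.pos hpq.pos
  have hlim := ((tendsto_sum_sigma_finset hσ).rpow_const (.inr hqp.le)).const_mul
    (M ^ (q / p - 1))
  refine le_of_tendsto hlim (.of_forall fun K => ?_)
  have hσ₀ : ∀ x : Σ j, K j, 0 < σ x.1 x.2 := fun x => (hYσ x.1).pos x.2
  have hN : 0 ≤ ∑ x : Σ j, K j, σ x.1 x.2 ^ p :=
    Finset.sum_nonneg fun x _ => Real.rpow_nonneg (hσ₀ x).le p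
  have hD : 0 ≤ ∑ i, schattenNorm p (X i) ^ q :=
    Finset.sum_nonneg fun i _ => Real.rpow_nonneg (schattenNorm_nonneg p _) q
  have htest := norm_sum_inner_le_of_two_le hU hM hUM hpq hp hX
    (fun j => (s j).swap.restrict (K j)) (a := fun x => σ x.1 x.2 ^ (p - 1))
    fun x => Real.rpow_pos_of_pos (hσ₀ x) _
  simp only [← hYX] at htest
  rw [sum_mul_inner_left_apply_right hYσ] at htest
  simp only [rpow_sub_one_mul_self (hσ₀ _).le hpq.ne_zero, ← Real.rpow_mul (hσ₀ _).le,
    hpq.sub_one_mul_conj] at htest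
  rw [Complex.norm_of_nonneg hN, mul_comm (∑ x : Σ j, K j, _)] at htest
  have hbound := Real.rpow_le_rpow hN (le_rpow_mul_rpow_of_le_mul_rpow hpq.symm
    (Real.rpow_nonneg hM _) hD hN htest) hqp.le
  have hexp : (1 - 2 / p) * p * (q / p) = -(q / p - 1) := by
    rw [sub_mul, div_mul_cancel₀ _ hpq.ne_zero]
    linear_combination mul_div_cancel₀ q hpq.ne_zero - hpq.symm.div_conj_eq_sub_one
  rw [Real.mul_rpow (by positivity) (by positivity), ← Real.rpow_mul hM, ← Real.rpow_mul hM, hexp,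
    ← Real.rpow_mul hD, div_mul_div_cancel₀ hpq.symm.ne_zero,
    div_self hpq.ne_zero, Real.rpow_one] at hbound
  rw [← neg_neg (q / p - 1), Real.rpow_neg hM]
  exact inv_mul_le_of_le_mul₀ (Real.rpow_nonneg hM _) hD hbound

end Duality

theorem norm_le_maxEntry {s t : ℕ} (U : Matrix (Fin s) (Fin t) ℂ) (i : Fin s) (j : Fin t) :
    ‖U i j‖ ≤ maxEntry U :=
  le_ciSup (f := fun k : Fin s × Fin t => ‖U k.1 k.2‖) (Set.finite_range _).bddAbove (i, j)

theorem maxEntry_nonneg {s t : ℕ} (U : Matrix (Fin s) (Fin t) ℂ) : 0 ≤ maxEntry U :=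
  Real.iSup_nonneg fun _ => norm_nonneg _

theorem theorem1p9_general {H I J : Type*} [NormedAddCommGroup H] [InnerProductSpace ℂ H]
    [CompleteSpace H] [Fintype I] [Fintype J] [DecidableEq J] {U : Matrix I J ℂ}
    (hU : U.conjTranspose * U = 1) {M : ℝ} (hM : 0 ≤ M) (hUM : ∀ i j, ‖U i j‖ ≤ M)
    {p q : ℝ} (hpq : p.HolderConjugate q) {X : I → H →L[ℂ] H} {Y : J → H →L[ℂ] H}
    (hX : ∀ i, MemSchatten p (X i)) (hY : ∀ j, MemSchatten p (Y j)) :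
    (p ≤ 2 → (∀ i, X i = ∑ j, U i j • Y j) →
      ∑ i, schattenNorm p (X i) ^ q ≤
        M ^ (q / p - 1) * (∑ j, schattenNorm p (Y j) ^ p) ^ (q / p)) ∧
    (2 ≤ p → (∀ j, Y j = ∑ i, U i j • X i) →
      M ^ (q / p - 1) * (∑ j, schattenNorm p (Y j) ^ p) ^ (q / p) ≤
        ∑ i, schattenNorm p (X i) ^ q) :=
  ⟨fun hp => sum_schattenNorm_rpow_le hU hM hUM hpq hp hX hY,
    fun hp => le_sum_schattenNorm_rpow hU hM hUM hpq hp hX hY⟩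

theorem theorem1p9 {H : Type*} [NormedAddCommGroup H] [InnerProductSpace ℂ H] [CompleteSpace H]
    {s t : ℕ} (U : Matrix (Fin s) (Fin t) ℂ) (hU : IsSubunitary U)
    (p q : ℝ) (hpq : p.HolderConjugate q)
    (X : Fin s → H →L[ℂ] H) (Y : Fin t → H →L[ℂ] H)
    (hX : ∀ i, MemSchatten p (X i)) (hY : ∀ j, MemSchatten p (Y j)) :
    (p ≤ 2 → (∀ i, X i = ∑ j, U i j • Y j) →
      ∑ i, schattenNorm p (X i) ^ q ≤
        maxEntry U ^ (q / p - 1) * (∑ j, schattenNorm p (Y j) ^ p) ^ (q / p)) ∧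
    (2 ≤ p → (∀ i, X i = ∑ j, (starRingEnd ℂ) (U i j) • Y j) →
      maxEntry U ^ (q / p - 1) * (∑ j, schattenNorm p (Y j) ^ p) ^ (q / p) ≤
        ∑ i, schattenNorm p (X i) ^ q) :=
  (theorem1p9_general hU (maxEntry_nonneg U) (norm_le_maxEntry U) hpq hX hY).imp_right
    fun h hp hXY => h hp (eq_sum_smul_of_eq_sum_conj_smul hU hXY)
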